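/- For a real matrix $X\in\mathbb{R}^{m\times n}$ let $\sigma_1(X)\ge\dots\ge\sigma_{\min(m,n)}(X)\ge 0$ be its singular values, $\|X\|_{\mathrm{tr}}=\sum_{i=1}^{\min(m,n)}\sigma_i(X)$ its trace norm, and $\|X\|_{S_{1/3}}=\bigl(\sum_{i=1}^{\min(m,n)}\sigma_i(X)^{1/3}\bigr)^{3}$ its Schatten-$1/3$ quasi-norm. Fix $m,n,d$. For $X\in\mathbb{R}^{m\times n}$ with $\operatorname{rank}(X)\le d$, the tri-trace norm of $X$ is $$\|X\|_{\mathrm{Tri\text{-}tr}}=\min\bigl\{\|U\|_{\mathrm{tr}}\|V\|_{\mathrm{tr}}\|W\|_{\mathrm{tr}} : U\in\mathbb{R}^{m\times d},\ V\in\mathbb{R}^{d\times d},\ W\in\mathbb{R}^{n\times d},\ X=UVW^{T}\bigr\}.$$ **Theorem.** The minimum is attained for every $X\in\mathbb{R}^{m\times n}$ with $\operatorname{rank}(X)\le d$. The tri-trace norm is a quasi-norm on the matrices of rank at most $d$: for all $X$ with $\operatorname{rank}(X)\le d$ and all $a\in\mathbb{R}$ one has $\|X\|_{\mathrm{Tri\text{-}tr}}\ge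 0$, with equality if and only if $X=0$, and $\|aX\|_{\mathrm{Tri\text{-}tr}}=|a|\,\|X\|_{\mathrm{Tri\text{-}tr}}$; and there is a constant $\alpha\ge 1$ such that $\|X+Y\|_{\mathrm{Tri\text{-}tr}}\le\alpha\bigl(\|X\|_{\mathrm{Tri\text{-}tr}}+\|Y\|_{\mathrm{Tri\text{-}tr}}\bigr)$ whenever $X$, $Y$ and $X+Y$ have rank at most $d$. In particular, if $d\ge\min(m,n)$, it is a quasi-norm on the whole space $\mathbb{R}^{m\times n}$. Moreover, for every $X\in\mathbb{R}^{m\times n}$ with $\operatorname{rank}(X)\le d$, $$\|X\|_{\mathrm{Tri\text{-}tr}}=\|X\|_{S_{1/3}}.$$ -/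

import Mathlib

noncomputable section

/-- The `i`-th singular value (counted from `0`, in decreasing order) of a real `m × n` matrix,
regarded as a linear map from `ℝⁿ` to `ℝᵐ` with their Euclidean inner products. -/
def matSingularValue {m n : ℕ} (X : Matrix (Fin m) (Fin n) ℝ) (i : ℕ) : ℝ :=
  (Matrix.toEuclideanLin X).singularValues i

/-- The trace norm: the sum of the `min m n` singular values. -/
def traceNorm {m n : ℕ} (X : Matrix (Fin m) (Fin n) ℝ) : ℝ :=
  ∑ i ∈ Finset.range (min m n), matSingularValue X i

/-- The Schatten-`p` (quasi-)norm, `0 < p < ∞`. -/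
def schattenNorm {m n : ℕ} (p : ℝ) (X : Matrix (Fin m) (Fin n) ℝ) : ℝ :=
  (∑ i ∈ Finset.range (min m n), matSingularValue X i ^ p) ^ (1 / p)

/-- The values `‖U‖_tr ‖V‖_tr ‖W‖_tr` over all factorizations `X = U V Wᵀ` with `U` of size `m × d`,
`V` of size `d × d` and `W` of size `n × d`. -/
def triTraceValues {m n : ℕ} (d : ℕ) (X : Matrix (Fin m) (Fin n) ℝ) : Set ℝ :=
  {t | ∃ (U : Matrix (Fin m) (Fin d) ℝ) (V : Matrix (Fin d) (Fin d) ℝ)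
      (W : Matrix (Fin n) (Fin d) ℝ),
      X = U * V * W.transpose ∧ t = traceNorm U * traceNorm V * traceNorm W}

/-- The tri-trace norm with inner dimension `d`. It is meant for matrices of rank at most `d`;
the infimum is asserted to be a minimum in the theorem. -/
def triTraceNorm {m n : ℕ} (d : ℕ) (X : Matrix (Fin m) (Fin n) ℝ) : ℝ :=
  sInf (triTraceValues d X)

/-- `f` satisfies the axioms of a quasi-norm on the subset `S` of a real vector space. The subset
`S` is meant to be closed under scalar multiplication; it need not be closed under addition, so
the quasi-triangle inequality is required whenever `x`, `y` and `x + y` all lie in `S`. -/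
structure IsQuasiNormOn {E : Type*} [AddCommGroup E] [Module ℝ E] (S : Set E) (f : E → ℝ) :
    Prop where
  nonneg : ∀ x ∈ S, 0 ≤ f x
  eq_zero_iff : ∀ x ∈ S, (f x = 0 ↔ x = 0)
  smul : ∀ (a : ℝ), ∀ x ∈ S, f (a • x) = |a| * f x
  add_le : ∃ α : ℝ, 1 ≤ α ∧
    ∀ x ∈ S, ∀ y ∈ S, x + y ∈ S → f (x + y) ≤ α * (f x + f y)

/-- `f` is a quasi-norm on the real vector space `E`. -/
def IsQuasiNorm {E : Type*} [AddCommGroup E] [Module ℝ E] (f : E → ℝ) : Prop :=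
  IsQuasiNormOn Set.univ f

end

/-!
Both inequalities between the tri-trace norm and the Schatten-`1/3` quasi-norm come from Ky Fan's
bound: for orthonormal families `e` and `f`, the sum `∑ |⟪e k, T (f k)⟫|` is at most the trace norm
of `T`, and more generally at most `∑ |s i| ‖p i‖ ‖q i‖` for every expansion of `T` as
`∑ s i • ⟪q i, ·⟫ • p i`, orthogonal or not.

Lower bound: let `T = A B C` have right singular vectors `q i`. Gram–Schmidt applied to the vectors
`C (q i)` and `B (C (q i))` makes both families triangular, so each nonzero singular value of `T` is
a product of three diagonal coefficients, one of each factor, with respect to orthonormal families.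
Hölder's inequality with the exponents `1/3` and Ky Fan's bound for each factor give
`(∑ σ i ^ (1/3)) ^ 3 ≤ ‖A‖ ‖B‖ ‖C‖` in trace norms. Upper bound: writing each `σ i` as the cube of
its cube root splits a singular value decomposition into three factors of trace norm
`∑ σ i ^ (1/3)`.

This splitting needs no orthogonality of the outer families. Applied to the concatenation of the
singular value decompositions of `X` and `Y`, it shows that `∑ σ i ^ (1/3)` is subadditive, whence
the quasi-triangle inequality with the constant `4`, as `(x + y) ^ 3 ≤ 4 * (x ^ 3 + y ^ 3)`.
-/

open InnerProductSpace Module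

section RealInequalities

theorem rpow_third_pow_three {x : ℝ} (hx : 0 ≤ x) : (x ^ (1 / 3 : ℝ)) ^ 3 = x := by
  simpa only [one_div, Nat.cast_ofNat] using Real.rpow_inv_natCast_pow hx three_ne_zero

theorem mul_mul_le_pow_three {a b c t : ℝ} (hb : 0 ≤ b) (hc : 0 ≤ c) (hat : a ≤ t) (hbt : b ≤ t)
    (hct : c ≤ t) : a * b * c ≤ t ^ 3 := by
  have ht : 0 ≤ t := hb.trans hbt
  rw [pow_three']
  exact mul_le_mul (mul_le_mul hat hbt hb ht) hct hc (mul_nonneg ht ht)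

theorem sum_rpow_third_mul_mul_pow_three_le {ι : Type*} (s : Finset ι) {a b c : ι → ℝ}
    (ha : ∀ i ∈ s, 0 ≤ a i) (hb : ∀ i ∈ s, 0 ≤ b i) (hc : ∀ i ∈ s, 0 ≤ c i) :
    (∑ i ∈ s, (a i * b i * c i) ^ (1 / 3 : ℝ)) ^ 3 ≤
      (∑ i ∈ s, a i) * (∑ i ∈ s, b i) * ∑ i ∈ s, c i := by
  have hab : ∀ i ∈ s, 0 ≤ a i * b i := fun i hi => mul_nonneg (ha i hi) (hb i hi)
  have hA : 0 ≤ ∑ i ∈ s, a i := Finset.sum_nonneg ha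
  have hB : 0 ≤ ∑ i ∈ s, b i := Finset.sum_nonneg hb
  have hC : 0 ≤ ∑ i ∈ s, c i := Finset.sum_nonneg hc
  have two_factors : ∑ i ∈ s, (a i * b i) ^ (1 / 2 : ℝ) ≤
      (∑ i ∈ s, a i) ^ (1 / 2 : ℝ) * (∑ i ∈ s, b i) ^ (1 / 2 : ℝ) := by
    have htriple : Real.HolderTriple 1 1 (1 / 2) := ⟨by norm_num, by norm_num, by norm_num⟩
    simpa only [Real.rpow_one, div_one] using
      Real.Lr_rpow_le_Lp_mul_Lq_of_nonneg s htriple ha hb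
  have split_off : ∑ i ∈ s, (a i * b i * c i) ^ (1 / 3 : ℝ) ≤
      (∑ i ∈ s, (a i * b i) ^ (1 / 2 : ℝ)) ^ (2 / 3 : ℝ) * (∑ i ∈ s, c i) ^ (1 / 3 : ℝ) := by
    have htriple : Real.HolderTriple (1 / 2) 1 (1 / 3) := ⟨by norm_num, by norm_num, by norm_num⟩
    convert Real.Lr_rpow_le_Lp_mul_Lq_of_nonneg s htriple hab hc using 2 <;> norm_num
  have hsqrt : 0 ≤ ∑ i ∈ s, (a i * b i) ^ (1 / 2 : ℝ) :=
    Finset.sum_nonneg fun i hi => Real.rpow_nonneg (hab i hi) _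
  have hcbrt : 0 ≤ ∑ i ∈ s, (a i * b i * c i) ^ (1 / 3 : ℝ) :=
    Finset.sum_nonneg fun i hi => Real.rpow_nonneg (mul_nonneg (hab i hi) (hc i hi)) _
  calc (∑ i ∈ s, (a i * b i * c i) ^ (1 / 3 : ℝ)) ^ 3
      ≤ ((((∑ i ∈ s, a i) ^ (1 / 2 : ℝ) * (∑ i ∈ s, b i) ^ (1 / 2 : ℝ)) ^ (2 / 3 : ℝ)) *
          (∑ i ∈ s, c i) ^ (1 / 3 : ℝ)) ^ 3 := by
        gcongr
        exact split_off.trans (by gcongr)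
    _ = (((∑ i ∈ s, a i) * (∑ i ∈ s, b i) * ∑ i ∈ s, c i) ^ (1 / 3 : ℝ)) ^ 3 := by
        rw [← Real.mul_rpow hA hB, ← Real.rpow_mul (mul_nonneg hA hB),
          Real.mul_rpow (mul_nonneg hA hB) hC]
        norm_num
    _ = (∑ i ∈ s, a i) * (∑ i ∈ s, b i) * ∑ i ∈ s, c i :=
        rpow_third_pow_three (mul_nonneg (mul_nonneg hA hB) hC)

end RealInequalities

section InnerProductSpaces

variable {𝕜 E F G H : Type*} [RCLike 𝕜]
  [NormedAddCommGroup E] [InnerProductSpace 𝕜 E]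
  [NormedAddCommGroup F] [InnerProductSpace 𝕜 F]
  [NormedAddCommGroup G] [InnerProductSpace 𝕜 G]
  [NormedAddCommGroup H] [InnerProductSpace 𝕜 H]

section RankOneSum

variable {ι κ : Type*} [Fintype ι] [Fintype κ]

variable (𝕜) in
/-- The linear map `x ↦ ∑ i, s i • ⟪q i, x⟫ • p i`, a common form for singular value decompositions
and for expansions along families `p` and `q` that need not be orthonormal. -/
noncomputable def rankOneSum (s : ι → ℝ) (p : ι → F) (q : ι → E) : E →ₗ[𝕜] F :=
  ∑ i, (s i : 𝕜) • (rankOne 𝕜 (p i) (q i)).toLinearMap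

theorem rankOneSum_apply (s : ι → ℝ) (p : ι → F) (q : ι → E) (x : E) :
    rankOneSum 𝕜 s p q x = ∑ i, (s i : 𝕜) • inner 𝕜 (q i) x • p i := by
  simp [rankOneSum, LinearMap.sum_apply]

theorem rankOneSum_apply_self (s : ι → ℝ) (p : ι → F) {q : ι → E} (hq : Orthonormal 𝕜 q) (j : ι) :
    rankOneSum 𝕜 s p q (q j) = (s j : 𝕜) • p j := by
  classical
  simp [rankOneSum_apply, orthonormal_iff_ite.mp hq]

theorem rankOneSum_comp_rankOneSum (s t : ι → ℝ) (p : ι → G) {e : ι → F} (he : Orthonormal 𝕜 e)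
    (q : ι → E) :
    rankOneSum 𝕜 s p e ∘ₗ rankOneSum 𝕜 t e q = rankOneSum 𝕜 (fun i => s i * t i) p q := by
  ext x
  simp only [LinearMap.comp_apply, rankOneSum_apply t, rankOneSum_apply (fun i => s i * t i),
    map_sum, map_smul, rankOneSum_apply_self s p he, smul_smul, RCLike.ofReal_mul]
  exact Finset.sum_congr rfl fun i _ => by ring_nf

theorem rankOneSum_rpow_third_comp_comp {s : ι → ℝ} (hs : ∀ i, 0 ≤ s i) (p : ι → G) {e : ι → F}
    (he : Orthonormal 𝕜 e) (q : ι → E) :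
    rankOneSum 𝕜 (fun i => s i ^ (1 / 3 : ℝ)) p e ∘ₗ
        rankOneSum 𝕜 (fun i => s i ^ (1 / 3 : ℝ)) e e ∘ₗ
          rankOneSum 𝕜 (fun i => s i ^ (1 / 3 : ℝ)) e q =
      rankOneSum 𝕜 s p q := by
  rw [rankOneSum_comp_rankOneSum _ _ _ he, rankOneSum_comp_rankOneSum _ _ _ he]
  congr with i
  rw [← pow_three, rpow_third_pow_three (hs i)]

theorem adjoint_rankOneSum [FiniteDimensional 𝕜 E] [FiniteDimensional 𝕜 F] (s : ι → ℝ) (p : ι → F)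
    (q : ι → E) : LinearMap.adjoint (rankOneSum 𝕜 s p q) = rankOneSum 𝕜 s q p := by
  refine ((LinearMap.eq_adjoint_iff _ _).mpr fun x y => ?_).symm
  simp only [rankOneSum_apply, sum_inner, inner_sum, inner_smul_left, inner_smul_right,
    RCLike.conj_ofReal, inner_conj_symm]
  exact Finset.sum_congr rfl fun i _ => by ring

theorem rankOneSum_add_rankOneSum (s : ι → ℝ) (t : κ → ℝ) (p : ι → F) (p' : κ → F) (q : ι → E)
    (q' : κ → E) :
    rankOneSum 𝕜 s p q + rankOneSum 𝕜 t p' q' =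
      rankOneSum 𝕜 (Sum.elim s t) (Sum.elim p p') (Sum.elim q q') := by
  simp [rankOneSum, Fintype.sum_sum_type]

theorem smul_rankOneSum (a : 𝕜) (s : ι → ℝ) (p : ι → F) (q : ι → E) :
    a • rankOneSum 𝕜 s p q =
      rankOneSum 𝕜 (fun i => ‖a‖ * s i) (fun i => ((‖a‖ : 𝕜)⁻¹ * a) • p i) q := by
  rcases eq_or_ne a 0 with rfl | ha
  · simp [rankOneSum]
  have hnorm : (‖a‖ : 𝕜) ≠ 0 := RCLike.ofReal_ne_zero.mpr (norm_ne_zero_iff.mpr ha)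
  ext x
  simp only [LinearMap.smul_apply, rankOneSum_apply, Finset.smul_sum, smul_smul,
    RCLike.ofReal_mul]
  exact Finset.sum_congr rfl fun i _ => by field_simp

theorem sum_norm_inner_mul_norm_inner_le {e : κ → F} (he : Orthonormal 𝕜 e) {f : κ → E}
    (hf : Orthonormal 𝕜 f) (x : F) (y : E) :
    ∑ k, ‖inner 𝕜 (e k) x‖ * ‖inner 𝕜 (f k) y‖ ≤ ‖x‖ * ‖y‖ := by
  calc ∑ k, ‖inner 𝕜 (e k) x‖ * ‖inner 𝕜 (f k) y‖
      ≤ √(∑ k, ‖inner 𝕜 (e k) x‖ ^ 2) * √(∑ k, ‖inner 𝕜 (f k) y‖ ^ 2) :=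
        Real.sum_mul_le_sqrt_mul_sqrt _ _ _
    _ ≤ √(‖x‖ ^ 2) * √(‖y‖ ^ 2) := by
        gcongr
        · exact he.sum_inner_products_le x
        · exact hf.sum_inner_products_le y
    _ = ‖x‖ * ‖y‖ := by rw [Real.sqrt_sq (norm_nonneg x), Real.sqrt_sq (norm_nonneg y)]

theorem sum_norm_inner_rankOneSum_le (s : ι → ℝ) (p : ι → F) (q : ι → E) {e : κ → F}
    (he : Orthonormal 𝕜 e) {f : κ → E} (hf : Orthonormal 𝕜 f) :
    ∑ k, ‖inner 𝕜 (e k) (rankOneSum 𝕜 s p q (f k))‖ ≤ ∑ i, |s i| * (‖p i‖ * ‖q i‖) := by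
  have triangle (k : κ) : ‖inner 𝕜 (e k) (rankOneSum 𝕜 s p q (f k))‖ ≤
      ∑ i, |s i| * (‖inner 𝕜 (e k) (p i)‖ * ‖inner 𝕜 (f k) (q i)‖) := by
    rw [rankOneSum_apply, inner_sum]
    refine norm_sum_le_of_le _ fun i _ => le_of_eq ?_
    rw [inner_smul_right, inner_smul_right, norm_mul, norm_mul, RCLike.norm_ofReal,
      norm_inner_symm (q i), mul_comm ‖inner 𝕜 (f k) (q i)‖]
  calc ∑ k, ‖inner 𝕜 (e k) (rankOneSum 𝕜 s p q (f k))‖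
      ≤ ∑ k, ∑ i, |s i| * (‖inner 𝕜 (e k) (p i)‖ * ‖inner 𝕜 (f k) (q i)‖) :=
        Finset.sum_le_sum fun k _ => triangle k
    _ = ∑ i, |s i| * ∑ k, ‖inner 𝕜 (e k) (p i)‖ * ‖inner 𝕜 (f k) (q i)‖ := by
        rw [Finset.sum_comm]
        simp_rw [Finset.mul_sum]
    _ ≤ ∑ i, |s i| * (‖p i‖ * ‖q i‖) := by
        gcongr with i
        exact sum_norm_inner_mul_norm_inner_le he hf (p i) (q i)

end RankOneSum

section SingularVectors

variable [FiniteDimensional 𝕜 E] [FiniteDimensional 𝕜 F] (T : E →ₗ[𝕜] F)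

/-- The right singular vectors of `T` that belong to its nonzero singular values. -/
noncomputable def rightSingularVector (i : Fin (finrank 𝕜 T.range)) : E :=
  T.isSymmetric_adjoint_comp_self.eigenvectorBasis rfl (Fin.castLE T.finrank_range_le i)

/-- The left singular vectors of `T` that belong to its nonzero singular values. -/
noncomputable def leftSingularVector (i : Fin (finrank 𝕜 T.range)) : F :=
  ((T.singularValues i : ℝ) : 𝕜)⁻¹ • T (rightSingularVector T i)

theorem inner_map_map_eigenvectorBasis (i j : Fin (finrank 𝕜 E)) :
    inner 𝕜 (T (T.isSymmetric_adjoint_comp_self.eigenvectorBasis rfl i))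
      (T (T.isSymmetric_adjoint_comp_self.eigenvectorBasis rfl j)) =
      if i = j then ((T.singularValues j : ℝ) : 𝕜) ^ 2 else 0 := by
  rw [← LinearMap.adjoint_inner_right, ← LinearMap.comp_apply,
    LinearMap.IsSymmetric.apply_eigenvectorBasis, inner_smul_right,
    orthonormal_iff_ite.mp (OrthonormalBasis.orthonormal _), mul_ite, mul_one, mul_zero,
    ← T.sq_singularValues_fin rfl, RCLike.ofReal_pow]

theorem map_eigenvectorBasis_eq_zero {j : Fin (finrank 𝕜 E)} (hj : finrank 𝕜 T.range ≤ j) :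
    T (T.isSymmetric_adjoint_comp_self.eigenvectorBasis rfl j) = 0 := by
  rw [← inner_self_eq_zero (𝕜 := 𝕜), inner_map_map_eigenvectorBasis, if_pos rfl,
    T.singularValues_eq_zero_iff_le_finrank_range.mpr hj, RCLike.ofReal_zero, zero_pow two_ne_zero]

theorem singularValues_ne_zero (i : Fin (finrank 𝕜 T.range)) :
    ((T.singularValues i : ℝ) : 𝕜) ≠ 0 :=
  RCLike.ofReal_ne_zero.mpr (T.singularValues_pos_iff_lt_finrank_range.mpr i.2).ne'

theorem map_rightSingularVector (i : Fin (finrank 𝕜 T.range)) :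
    T (rightSingularVector T i) = ((T.singularValues i : ℝ) : 𝕜) • leftSingularVector T i :=
  (smul_inv_smul₀ (singularValues_ne_zero T i) _).symm

theorem orthonormal_rightSingularVector : Orthonormal 𝕜 (rightSingularVector T) :=
  (OrthonormalBasis.orthonormal _).comp _ (Fin.castLE_injective T.finrank_range_le)

theorem orthonormal_leftSingularVector : Orthonormal 𝕜 (leftSingularVector T) := by
  rw [orthonormal_iff_ite]
  intro i j
  rw [leftSingularVector, leftSingularVector, inner_smul_left, inner_smul_right,
    rightSingularVector, rightSingularVector, inner_map_map_eigenvectorBasis]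
  rcases eq_or_ne i j with rfl | hij
  · have := singularValues_ne_zero T i
    simp only [if_true, Fin.val_castLE, map_inv₀, RCLike.conj_ofReal]
    field_simp
  · simp [hij]

theorem rankOneSum_singularValues :
    rankOneSum 𝕜 (fun i : Fin (finrank 𝕜 T.range) => T.singularValues i)
      (leftSingularVector T) (rightSingularVector T) = T := by
  set b := T.isSymmetric_adjoint_comp_self.eigenvectorBasis rfl
  refine b.toBasis.ext fun j => ?_
  rw [OrthonormalBasis.coe_toBasis]
  rcases lt_or_ge (j : ℕ) (finrank 𝕜 T.range) with hj | hj
  · have hbj : b j = rightSingularVector T ⟨j, hj⟩ := rfl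
    rw [hbj, rankOneSum_apply_self _ _ (orthonormal_rightSingularVector T),
      map_rightSingularVector]
  · rw [map_eigenvectorBasis_eq_zero T hj, rankOneSum_apply]
    refine Finset.sum_eq_zero fun i _ => ?_
    have hij : Fin.castLE T.finrank_range_le i ≠ j := fun h => hj.not_gt (h ▸ i.2)
    rw [rightSingularVector, b.orthonormal.2 hij, zero_smul, smul_zero]

end SingularVectors

section SingularValueSums

variable [FiniteDimensional 𝕜 E] [FiniteDimensional 𝕜 F]

/-- The nuclear norm (also trace norm or Schatten `1`-norm): the sum of the singular values. -/
noncomputable def nuclearNorm (T : E →ₗ[𝕜] F) : ℝ :=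
  T.singularValues.sum fun _ σ => σ

/-- The sum of the `p`-th powers of the nonzero singular values, that is, the `p`-th power of the
Schatten `p`-(quasi-)norm. -/
noncomputable def schattenSum (p : ℝ) (T : E →ₗ[𝕜] F) : ℝ :=
  T.singularValues.sum fun _ σ => σ ^ p

variable (T : E →ₗ[𝕜] F)

theorem sum_singularValues_eq_sum_fin (φ : ℝ → ℝ) :
    (T.singularValues.sum fun _ σ => φ σ) =
      ∑ i : Fin (finrank 𝕜 T.range), φ (T.singularValues i) := by
  rw [Finsupp.sum, T.support_singularValues, Finset.sum_range]

theorem sum_singularValues_eq_sum_range {φ : ℝ → ℝ} (hφ : φ 0 = 0) {N : ℕ}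
    (hN : finrank 𝕜 T.range ≤ N) :
    (T.singularValues.sum fun _ σ => φ σ) = ∑ i ∈ Finset.range N, φ (T.singularValues i) :=
  Finsupp.sum_of_support_subset _
    (T.support_singularValues ▸ Finset.range_mono hN) _ fun _ _ => hφ

theorem nuclearNorm_eq_sum_fin :
    nuclearNorm T = ∑ i : Fin (finrank 𝕜 T.range), T.singularValues i :=
  sum_singularValues_eq_sum_fin T fun σ => σ

theorem schattenSum_eq_sum_fin (p : ℝ) :
    schattenSum p T = ∑ i : Fin (finrank 𝕜 T.range), T.singularValues i ^ p :=
  sum_singularValues_eq_sum_fin T (· ^ p)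

theorem nuclearNorm_nonneg : 0 ≤ nuclearNorm T :=
  Finsupp.sum_nonneg fun i _ => T.singularValues_nonneg i

theorem schattenSum_nonneg (p : ℝ) : 0 ≤ schattenSum p T :=
  Finsupp.sum_nonneg fun i _ => Real.rpow_nonneg (T.singularValues_nonneg i) p

theorem schattenSum_eq_zero_iff (p : ℝ) : schattenSum p T = 0 ↔ T = 0 := by
  have hpos : ∀ i ∈ T.singularValues.support, 0 < T.singularValues i ^ p := fun i hi =>
    Real.rpow_pos_of_pos
      ((T.singularValues_pos_iff_ne_zero i).mpr (Finsupp.mem_support_iff.mp hi)) p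
  rw [← T.singularValues_eq_zero_iff, ← Finsupp.support_eq_empty, schattenSum, Finsupp.sum,
    Finset.sum_eq_zero_iff_of_nonneg fun i hi => (hpos i hi).le]
  exact ⟨fun h => Finset.eq_empty_of_forall_notMem fun i hi => (hpos i hi).ne' (h i hi),
    fun h i hi => absurd hi (h ▸ Finset.notMem_empty i)⟩

theorem nuclearNorm_eq_sum_norm_inner :
    nuclearNorm T = ∑ i, ‖inner 𝕜 (leftSingularVector T i) (T (rightSingularVector T i))‖ := by
  rw [nuclearNorm_eq_sum_fin]
  refine Finset.sum_congr rfl fun i _ => ?_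
  rw [map_rightSingularVector, inner_smul_right,
    inner_self_eq_one_of_norm_eq_one ((orthonormal_leftSingularVector T).1 i), mul_one,
    RCLike.norm_of_nonneg (T.singularValues_nonneg i)]

theorem sum_norm_inner_le_nuclearNorm {κ : Type*} [Fintype κ] {e : κ → F} (he : Orthonormal 𝕜 e)
    {f : κ → E} (hf : Orthonormal 𝕜 f) :
    ∑ k, ‖inner 𝕜 (e k) (T (f k))‖ ≤ nuclearNorm T := by
  have hbound := sum_norm_inner_rankOneSum_le (fun i : Fin (finrank 𝕜 T.range) =>
    T.singularValues i) (leftSingularVector T) (rightSingularVector T) he hf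
  rw [rankOneSum_singularValues] at hbound
  refine hbound.trans_eq ?_
  rw [nuclearNorm_eq_sum_fin]
  refine Finset.sum_congr rfl fun i _ => ?_
  rw [(orthonormal_leftSingularVector T).1, (orthonormal_rightSingularVector T).1, mul_one,
    mul_one, abs_of_nonneg (T.singularValues_nonneg i)]

theorem nuclearNorm_rankOneSum_le {ι : Type*} [Fintype ι] (s : ι → ℝ) (p : ι → F) (q : ι → E) :
    nuclearNorm (rankOneSum 𝕜 s p q) ≤ ∑ i, |s i| * (‖p i‖ * ‖q i‖) := by
  rw [nuclearNorm_eq_sum_norm_inner]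
  exact sum_norm_inner_rankOneSum_le s p q (orthonormal_leftSingularVector _)
    (orthonormal_rightSingularVector _)

theorem nuclearNorm_adjoint_le : nuclearNorm (LinearMap.adjoint T) ≤ nuclearNorm T := by
  rw [nuclearNorm_eq_sum_norm_inner (LinearMap.adjoint T)]
  simp_rw [LinearMap.adjoint_inner_right, norm_inner_symm (T _)]
  exact sum_norm_inner_le_nuclearNorm T (orthonormal_rightSingularVector _)
    (orthonormal_leftSingularVector _)

theorem nuclearNorm_adjoint : nuclearNorm (LinearMap.adjoint T) = nuclearNorm T := by
  refine le_antisymm (nuclearNorm_adjoint_le T) ?_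
  simpa only [LinearMap.adjoint_adjoint] using nuclearNorm_adjoint_le (LinearMap.adjoint T)

end SingularValueSums

section GramSchmidt

variable {ι : Type*} [LinearOrder ι] [LocallyFiniteOrderBot ι] [WellFoundedLT ι]

theorem inner_gramSchmidtNormed_of_lt (v : ι → E) {k i : ι} (hki : k < i) :
    inner 𝕜 (gramSchmidtNormed 𝕜 v i) (v k) = 0 := by
  rw [gramSchmidtNormed, inner_smul_left, gramSchmidt_inv_triangular 𝕜 v hki, mul_zero]

theorem inner_gramSchmidt_self (v : ι → E) (i : ι) :
    inner 𝕜 (gramSchmidt 𝕜 v i) (v i) = (‖gramSchmidt 𝕜 v i‖ : 𝕜) ^ 2 := by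
  conv_lhs => rw [gramSchmidt_def'' 𝕜 v i]
  rw [inner_add_right, inner_self_eq_norm_sq_to_K, inner_sum, Finset.sum_eq_zero, add_zero]
  intro k hk
  rw [inner_smul_right, gramSchmidt_orthogonal 𝕜 v (Finset.mem_Iio.mp hk).ne', mul_zero]

theorem map_eq_inner_gramSchmidtNormed_smul {M : Type*} [AddCommGroup M] [Module 𝕜 M]
    (φ : E →ₗ[𝕜] M) (v : ι → E) {i : ι} (hφ : ∀ k < i, φ (v k) = 0) :
    φ (v i) = inner 𝕜 (gramSchmidtNormed 𝕜 v i) (v i) • φ (gramSchmidtNormed 𝕜 v i) := by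
  have hker : Submodule.span 𝕜 (gramSchmidt 𝕜 v '' Set.Iio i) ≤ φ.ker := by
    rw [span_gramSchmidt_Iio, Submodule.span_le]
    rintro _ ⟨k, hk, rfl⟩
    exact hφ k hk
  have hearlier (k : ι) (hk : k ∈ Finset.Iio i) : φ (gramSchmidt 𝕜 v k) = 0 :=
    hker (Submodule.subset_span ⟨k, Finset.mem_Iio.mp hk, rfl⟩)
  have hmap : φ (v i) = φ (gramSchmidt 𝕜 v i) := by
    conv_lhs => rw [gramSchmidt_def'' 𝕜 v i]
    rw [map_add, map_sum, Finset.sum_eq_zero, add_zero]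
    intro k hk
    rw [map_smul, hearlier k hk, smul_zero]
  rw [hmap, gramSchmidtNormed, inner_smul_left, inner_gramSchmidt_self, map_smul, smul_smul]
  rcases eq_or_ne (gramSchmidt 𝕜 v i) 0 with hzero | hne
  · rw [hzero, map_zero, smul_zero]
  · have : (‖gramSchmidt 𝕜 v i‖ : 𝕜) ≠ 0 := RCLike.ofReal_ne_zero.mpr (norm_ne_zero_iff.mpr hne)
    rw [map_inv₀, RCLike.conj_ofReal]
    field_simp
    rw [one_smul]

theorem exists_orthonormal_eq_inner_mul_inner_mul_inner (A : F →ₗ[𝕜] G) (B : E →ₗ[𝕜] F)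
    (C : H →ₗ[𝕜] E) {σ : ι → 𝕜} (hσ : ∀ i, σ i ≠ 0) {p : ι → G} (hp : Orthonormal 𝕜 p) {q : ι → H}
    (h : ∀ i, A (B (C (q i))) = σ i • p i) :
    ∃ (g : ι → F) (f : ι → E), Orthonormal 𝕜 g ∧ Orthonormal 𝕜 f ∧ ∀ i,
      σ i = inner 𝕜 (p i) (A (g i)) * inner 𝕜 (g i) (B (f i)) * inner 𝕜 (f i) (C (q i)) := by
  set w : ι → E := fun i => C (q i)
  set v : ι → F := fun i => B (w i)
  have hAv : LinearIndependent 𝕜 (A ∘ v) := by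
    rw [show A ∘ v = (fun i => Units.mk0 (σ i) (hσ i)) • p from funext h]
    exact hp.linearIndependent.units_smul _
  have hv : LinearIndependent 𝕜 v := hAv.of_comp A
  have hw : LinearIndependent 𝕜 w := hv.of_comp B
  set g := gramSchmidtNormed 𝕜 v
  set f := gramSchmidtNormed 𝕜 w
  refine ⟨g, f, gramSchmidtNormed_orthonormal hv, gramSchmidtNormed_orthonormal hw, fun i => ?_⟩
  have hA : inner 𝕜 (p i) (A (v i)) = inner 𝕜 (g i) (v i) * inner 𝕜 (p i) (A (g i)) :=
    map_eq_inner_gramSchmidtNormed_smul (innerₛₗ 𝕜 (p i) ∘ₗ A) v fun k hk => by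
      rw [LinearMap.comp_apply, h k, map_smul, innerₛₗ_apply_apply, hp.2 hk.ne', smul_zero]
  have hB : inner 𝕜 (g i) (B (w i)) = inner 𝕜 (f i) (w i) * inner 𝕜 (g i) (B (f i)) :=
    map_eq_inner_gramSchmidtNormed_smul (innerₛₗ 𝕜 (g i) ∘ₗ B) w fun k hk =>
      inner_gramSchmidtNormed_of_lt v hk
  calc σ i = inner 𝕜 (p i) (A (v i)) := by
        rw [h i, inner_smul_right, inner_self_eq_one_of_norm_eq_one (hp.1 i), mul_one]
    _ = inner 𝕜 (p i) (A (g i)) * inner 𝕜 (g i) (B (f i)) * inner 𝕜 (f i) (w i) := by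
        rw [hA, hB]
        ring

end GramSchmidt

section SchattenOneThird

variable [FiniteDimensional 𝕜 E] [FiniteDimensional 𝕜 F] [FiniteDimensional 𝕜 G]
  [FiniteDimensional 𝕜 H]

theorem schattenSum_third_comp_comp_pow_three_le (A : F →ₗ[𝕜] G) (B : E →ₗ[𝕜] F)
    (C : H →ₗ[𝕜] E) :
    schattenSum (1 / 3) (A ∘ₗ B ∘ₗ C) ^ 3 ≤ nuclearNorm A * nuclearNorm B * nuclearNorm C := by
  set T := A ∘ₗ B ∘ₗ C
  set p := leftSingularVector T
  set q := rightSingularVector T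
  have hp : Orthonormal 𝕜 p := orthonormal_leftSingularVector T
  have hq : Orthonormal 𝕜 q := orthonormal_rightSingularVector T
  obtain ⟨g, f, hg, hf, hσ⟩ := exists_orthonormal_eq_inner_mul_inner_mul_inner A B C
    (singularValues_ne_zero T) hp (map_rightSingularVector T)
  have hσ_norm (i : Fin (finrank 𝕜 T.range)) : T.singularValues i =
      ‖inner 𝕜 (p i) (A (g i))‖ * ‖inner 𝕜 (g i) (B (f i))‖ * ‖inner 𝕜 (f i) (C (q i))‖ := by
    rw [← norm_mul, ← norm_mul, ← hσ, RCLike.norm_of_nonneg (T.singularValues_nonneg i)]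
  calc schattenSum (1 / 3) T ^ 3
      ≤ (∑ i, ‖inner 𝕜 (p i) (A (g i))‖) * (∑ i, ‖inner 𝕜 (g i) (B (f i))‖) *
          ∑ i, ‖inner 𝕜 (f i) (C (q i))‖ := by
        rw [schattenSum_eq_sum_fin]
        simp_rw [hσ_norm]
        exact sum_rpow_third_mul_mul_pow_three_le _ (fun _ _ => norm_nonneg _)
          (fun _ _ => norm_nonneg _) fun _ _ => norm_nonneg _
    _ ≤ nuclearNorm A * nuclearNorm B * nuclearNorm C := by
        have hA := nuclearNorm_nonneg A
        have hB := nuclearNorm_nonneg B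
        gcongr
        · exact sum_norm_inner_le_nuclearNorm A hp hg
        · exact sum_norm_inner_le_nuclearNorm B hg hf
        · exact sum_norm_inner_le_nuclearNorm C hf hq

variable {ι κ : Type*} [Fintype ι] [Fintype κ]

theorem nuclearNorm_rankOneSum_le_sum {s : ι → ℝ} (hs : ∀ i, 0 ≤ s i) {p : ι → F}
    (hp : ∀ i, ‖p i‖ ≤ 1) {q : ι → E} (hq : ∀ i, ‖q i‖ ≤ 1) :
    nuclearNorm (rankOneSum 𝕜 s p q) ≤ ∑ i, s i := by
  refine (nuclearNorm_rankOneSum_le s p q).trans (Finset.sum_le_sum fun i _ => ?_)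
  rw [abs_of_nonneg (hs i)]
  exact mul_le_of_le_one_right (hs i) (mul_le_one₀ (hp i) (norm_nonneg _) (hq i))

theorem schattenSum_third_rankOneSum_le {s : ι → ℝ} (hs : ∀ i, 0 ≤ s i) {p : ι → F}
    (hp : ∀ i, ‖p i‖ ≤ 1) {q : ι → E} (hq : ∀ i, ‖q i‖ ≤ 1) :
    schattenSum (1 / 3) (rankOneSum 𝕜 s p q) ≤ ∑ i, s i ^ (1 / 3 : ℝ) := by
  classical
  have he : Orthonormal 𝕜 (EuclideanSpace.basisFun ι 𝕜) := OrthonormalBasis.orthonormal _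
  have he_norm (i : ι) : ‖EuclideanSpace.basisFun ι 𝕜 i‖ ≤ 1 := (he.1 i).le
  have hroot (i : ι) : 0 ≤ s i ^ (1 / 3 : ℝ) := Real.rpow_nonneg (hs i) _
  have hsum : 0 ≤ ∑ i, s i ^ (1 / 3 : ℝ) := Finset.sum_nonneg fun i _ => hroot i
  refine le_of_pow_le_pow_left₀ three_ne_zero hsum ?_
  rw [← rankOneSum_rpow_third_comp_comp hs p he q]
  refine (schattenSum_third_comp_comp_pow_three_le _ _ _).trans ?_
  exact mul_mul_le_pow_three (nuclearNorm_nonneg _) (nuclearNorm_nonneg _)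
    (nuclearNorm_rankOneSum_le_sum hroot hp he_norm)
    (nuclearNorm_rankOneSum_le_sum hroot he_norm he_norm)
    (nuclearNorm_rankOneSum_le_sum hroot he_norm hq)

theorem schattenSum_third_add_le (S T : E →ₗ[𝕜] F) :
    schattenSum (1 / 3) (S + T) ≤ schattenSum (1 / 3) S + schattenSum (1 / 3) T := by
  conv_lhs => rw [← rankOneSum_singularValues S, ← rankOneSum_singularValues T,
    rankOneSum_add_rankOneSum]
  refine (schattenSum_third_rankOneSum_le ?_ ?_ ?_).trans_eq ?_
  · exact Sum.forall.mpr ⟨fun i => S.singularValues_nonneg i, fun i => T.singularValues_nonneg i⟩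
  · exact Sum.forall.mpr ⟨fun i => ((orthonormal_leftSingularVector S).1 i).le,
      fun i => ((orthonormal_leftSingularVector T).1 i).le⟩
  · exact Sum.forall.mpr ⟨fun i => ((orthonormal_rightSingularVector S).1 i).le,
      fun i => ((orthonormal_rightSingularVector T).1 i).le⟩
  · rw [Fintype.sum_sum_type, schattenSum_eq_sum_fin, schattenSum_eq_sum_fin]
    rfl

theorem schattenSum_third_smul_le (a : 𝕜) (T : E →ₗ[𝕜] F) :
    schattenSum (1 / 3) (a • T) ≤ ‖a‖ ^ (1 / 3 : ℝ) * schattenSum (1 / 3) T := by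
  have hphase : ‖(‖a‖ : 𝕜)⁻¹ * a‖ ≤ 1 := by
    rw [norm_mul, norm_inv, RCLike.norm_coe_norm]
    exact inv_mul_le_one
  conv_lhs => rw [← rankOneSum_singularValues T, smul_rankOneSum]
  refine (schattenSum_third_rankOneSum_le ?_ ?_ ?_).trans_eq ?_
  · exact fun i => mul_nonneg (norm_nonneg a) (T.singularValues_nonneg i)
  · intro i
    rwa [norm_smul, (orthonormal_leftSingularVector T).1, mul_one]
  · exact fun i => ((orthonormal_rightSingularVector T).1 i).le
  · rw [schattenSum_eq_sum_fin, Finset.mul_sum]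
    exact Finset.sum_congr rfl fun i _ =>
      Real.mul_rpow (norm_nonneg a) (T.singularValues_nonneg i)

theorem schattenSum_third_smul (a : 𝕜) (T : E →ₗ[𝕜] F) :
    schattenSum (1 / 3) (a • T) = ‖a‖ ^ (1 / 3 : ℝ) * schattenSum (1 / 3) T := by
  refine le_antisymm (schattenSum_third_smul_le a T) ?_
  rcases eq_or_ne a 0 with rfl | ha
  · rw [norm_zero, Real.zero_rpow (by norm_num), zero_mul]
    exact schattenSum_nonneg _ _
  · have hinv := schattenSum_third_smul_le a⁻¹ (a • T)
    rwa [inv_smul_smul₀ ha, norm_inv, Real.inv_rpow (norm_nonneg a),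
      le_inv_mul_iff₀ (Real.rpow_pos_of_pos (norm_pos_iff.mpr ha) _)] at hinv

end SchattenOneThird

end InnerProductSpaces

section Matrices

variable {m n d : ℕ}

theorem finrank_range_toEuclideanLin (X : Matrix (Fin m) (Fin n) ℝ) :
    finrank ℝ (Matrix.toEuclideanLin X).range = X.rank := by
  rw [Matrix.toEuclideanLin_eq_toLin_orthonormal]
  exact (Matrix.rank_eq_finrank_range_toLin X _ _).symm

theorem rank_le_min {R : Type*} [CommSemiring R] [StrongRankCondition R]
    (X : Matrix (Fin m) (Fin n) R) : X.rank ≤ min m n :=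
  le_min X.rank_le_height X.rank_le_width

theorem rank_smul_le {R : Type*} [CommSemiring R] [StrongRankCondition R] (a : R)
    (X : Matrix (Fin m) (Fin n) R) : (a • X).rank ≤ X.rank := by
  rw [← Matrix.mul_one X, ← Matrix.mul_smul, Matrix.mul_one]
  exact Matrix.rank_mul_le_left X _

theorem sum_range_min_matSingularValue {φ : ℝ → ℝ} (hφ : φ 0 = 0) (X : Matrix (Fin m) (Fin n) ℝ) :
    ∑ i ∈ Finset.range (min m n), φ (matSingularValue X i) =
      (Matrix.toEuclideanLin X).singularValues.sum fun _ σ => φ σ :=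
  (sum_singularValues_eq_sum_range _ hφ
    ((finrank_range_toEuclideanLin X).trans_le (rank_le_min X))).symm

theorem traceNorm_eq_nuclearNorm (X : Matrix (Fin m) (Fin n) ℝ) :
    traceNorm X = nuclearNorm (Matrix.toEuclideanLin X) :=
  sum_range_min_matSingularValue (φ := fun σ => σ) rfl X

theorem traceNorm_nonneg (X : Matrix (Fin m) (Fin n) ℝ) : 0 ≤ traceNorm X :=
  (traceNorm_eq_nuclearNorm X).symm ▸ nuclearNorm_nonneg _

theorem schattenNorm_third_eq (X : Matrix (Fin m) (Fin n) ℝ) :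
    schattenNorm (1 / 3) X = schattenSum (1 / 3) (Matrix.toEuclideanLin X) ^ 3 := by
  have hsum := sum_range_min_matSingularValue (φ := (· ^ (1 / 3 : ℝ)))
    (Real.zero_rpow (by norm_num)) X
  rw [schattenNorm, hsum, one_div_one_div]
  exact Real.rpow_natCast _ 3

theorem isQuasiNorm_schattenNorm_third (m n : ℕ) :
    IsQuasiNorm (schattenNorm (1 / 3) : Matrix (Fin m) (Fin n) ℝ → ℝ) where
  nonneg X _ := by
    rw [schattenNorm_third_eq]
    exact pow_nonneg (schattenSum_nonneg _ _) 3
  eq_zero_iff X _ := by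
    rw [schattenNorm_third_eq, pow_eq_zero_iff three_ne_zero, schattenSum_eq_zero_iff,
      LinearEquiv.map_eq_zero_iff]
  smul a X _ := by
    rw [schattenNorm_third_eq, schattenNorm_third_eq, map_smul, schattenSum_third_smul, mul_pow,
      rpow_third_pow_three (norm_nonneg a), Real.norm_eq_abs]
  add_le := by
    refine ⟨4, by norm_num, fun X _ Y _ _ => ?_⟩
    set S := schattenSum (1 / 3) (Matrix.toEuclideanLin X)
    set T := schattenSum (1 / 3) (Matrix.toEuclideanLin Y)
    rw [schattenNorm_third_eq, schattenNorm_third_eq X, schattenNorm_third_eq Y, map_add]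
    calc schattenSum (1 / 3) (Matrix.toEuclideanLin X + Matrix.toEuclideanLin Y) ^ 3
        ≤ (S + T) ^ 3 :=
          pow_le_pow_left₀ (schattenSum_nonneg _ _) (schattenSum_third_add_le _ _) 3
      _ ≤ 2 ^ (3 - 1) * (S ^ 3 + T ^ 3) :=
          add_pow_le (schattenSum_nonneg _ _) (schattenSum_nonneg _ _) 3
      _ = 4 * (S ^ 3 + T ^ 3) := by norm_num

theorem toEuclideanLin_mul_mul_transpose {k l : ℕ} (U : Matrix (Fin m) (Fin k) ℝ)
    (V : Matrix (Fin k) (Fin l) ℝ) (W : Matrix (Fin n) (Fin l) ℝ) :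
    Matrix.toEuclideanLin (U * V * W.transpose) = Matrix.toEuclideanLin U ∘ₗ
      Matrix.toEuclideanLin V ∘ₗ LinearMap.adjoint (Matrix.toEuclideanLin W) := by
  rw [← Matrix.toEuclideanLin_conjTranspose_eq_adjoint,
    Matrix.conjTranspose_eq_transpose_of_trivial, Matrix.toLpLin_mul_same,
    Matrix.toLpLin_mul_same, LinearMap.comp_assoc]

theorem schattenNorm_third_mul_mul_transpose_le {k l : ℕ} (U : Matrix (Fin m) (Fin k) ℝ)
    (V : Matrix (Fin k) (Fin l) ℝ) (W : Matrix (Fin n) (Fin l) ℝ) :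
    schattenNorm (1 / 3) (U * V * W.transpose) ≤ traceNorm U * traceNorm V * traceNorm W := by
  rw [schattenNorm_third_eq, toEuclideanLin_mul_mul_transpose, traceNorm_eq_nuclearNorm,
    traceNorm_eq_nuclearNorm, traceNorm_eq_nuclearNorm,
    ← nuclearNorm_adjoint (Matrix.toEuclideanLin W)]
  exact schattenSum_third_comp_comp_pow_three_le _ _ _

theorem traceNorm_toEuclideanLin_symm_rankOneSum_le {ι : Type*} [Fintype ι] {s : ι → ℝ}
    (hs : ∀ i, 0 ≤ s i) {p : ι → EuclideanSpace ℝ (Fin m)} (hp : ∀ i, ‖p i‖ ≤ 1)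
    {q : ι → EuclideanSpace ℝ (Fin n)} (hq : ∀ i, ‖q i‖ ≤ 1) :
    traceNorm (Matrix.toEuclideanLin.symm (rankOneSum ℝ s p q)) ≤ ∑ i, s i := by
  rw [traceNorm_eq_nuclearNorm, LinearEquiv.apply_symm_apply]
  exact nuclearNorm_rankOneSum_le_sum hs hp hq

theorem exists_eq_mul_mul_transpose_traceNorm_mul_le (X : Matrix (Fin m) (Fin n) ℝ)
    (hX : X.rank ≤ d) :
    ∃ (U : Matrix (Fin m) (Fin d) ℝ) (V : Matrix (Fin d) (Fin d) ℝ) (W : Matrix (Fin n) (Fin d) ℝ),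
      X = U * V * W.transpose ∧
        traceNorm U * traceNorm V * traceNorm W ≤ schattenNorm (1 / 3) X := by
  set T := Matrix.toEuclideanLin X
  have hr : finrank ℝ T.range ≤ d := (finrank_range_toEuclideanLin X).trans_le hX
  set e : Fin (finrank ℝ T.range) → EuclideanSpace ℝ (Fin d) :=
    fun i => EuclideanSpace.basisFun (Fin d) ℝ (Fin.castLE hr i)
  have he : Orthonormal ℝ e := (OrthonormalBasis.orthonormal _).comp _ (Fin.castLE_injective hr)
  have he_norm (i) : ‖e i‖ ≤ 1 := (he.1 i).le
  have hp_norm (i) : ‖leftSingularVector T i‖ ≤ 1 := ((orthonormal_leftSingularVector T).1 i).le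
  have hq_norm (i) : ‖rightSingularVector T i‖ ≤ 1 := ((orthonormal_rightSingularVector T).1 i).le
  set s : Fin (finrank ℝ T.range) → ℝ := fun i => T.singularValues i ^ (1 / 3 : ℝ)
  have hs (i) : 0 ≤ s i := Real.rpow_nonneg (T.singularValues_nonneg i) _
  refine ⟨Matrix.toEuclideanLin.symm (rankOneSum ℝ s (leftSingularVector T) e),
    Matrix.toEuclideanLin.symm (rankOneSum ℝ s e e),
    Matrix.toEuclideanLin.symm (rankOneSum ℝ s (rightSingularVector T) e), ?_, ?_⟩
  · apply Matrix.toEuclideanLin.injective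
    rw [toEuclideanLin_mul_mul_transpose, LinearEquiv.apply_symm_apply,
      LinearEquiv.apply_symm_apply, LinearEquiv.apply_symm_apply, adjoint_rankOneSum,
      rankOneSum_rpow_third_comp_comp (fun i : Fin (finrank ℝ T.range) =>
        T.singularValues_nonneg i) _ he,
      rankOneSum_singularValues]
  · rw [schattenNorm_third_eq, schattenSum_eq_sum_fin]
    exact mul_mul_le_pow_three (traceNorm_nonneg _) (traceNorm_nonneg _)
      (traceNorm_toEuclideanLin_symm_rankOneSum_le hs hp_norm he_norm)
      (traceNorm_toEuclideanLin_symm_rankOneSum_le hs he_norm he_norm)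
      (traceNorm_toEuclideanLin_symm_rankOneSum_le hs hq_norm he_norm)

theorem isLeast_triTraceValues (X : Matrix (Fin m) (Fin n) ℝ) (hX : X.rank ≤ d) :
    IsLeast (triTraceValues d X) (schattenNorm (1 / 3) X) := by
  constructor
  · obtain ⟨U, V, W, rfl, hle⟩ := exists_eq_mul_mul_transpose_traceNorm_mul_le X hX
    exact ⟨U, V, W, rfl, (schattenNorm_third_mul_mul_transpose_le U V W).antisymm hle⟩
  · rintro t ⟨U, V, W, rfl, rfl⟩
    exact schattenNorm_third_mul_mul_transpose_le U V W

theorem triTraceNorm_eq_schattenNorm_third (X : Matrix (Fin m) (Fin n) ℝ) (hX : X.rank ≤ d) :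
    triTraceNorm d X = schattenNorm (1 / 3) X :=
  (isLeast_triTraceValues X hX).csInf_eq

end Matrices

theorem IsQuasiNorm.isQuasiNormOn_of_eqOn {E : Type*} [AddCommGroup E] [Module ℝ E] {S : Set E}
    {f g : E → ℝ} (hg : IsQuasiNorm g) (hS : ∀ a : ℝ, ∀ x ∈ S, a • x ∈ S) (hfg : Set.EqOn f g S) :
    IsQuasiNormOn S f where
  nonneg x hx := hfg hx ▸ hg.nonneg x trivial
  eq_zero_iff x hx := hfg hx ▸ hg.eq_zero_iff x trivial
  smul a x hx := by
    rw [hfg hx, hfg (hS a x hx)]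
    exact hg.smul a x trivial
  add_le := by
    obtain ⟨α, hα, hadd⟩ := hg.add_le
    refine ⟨α, hα, fun x hx y hy hxy => ?_⟩
    rw [hfg hx, hfg hy, hfg hxy]
    exact hadd x trivial y trivial trivial

theorem theorem2 (m n d : ℕ) :
    (∀ X : Matrix (Fin m) (Fin n) ℝ, X.rank ≤ d →
      IsLeast (triTraceValues d X) (triTraceNorm d X)) ∧
    IsQuasiNormOn {X : Matrix (Fin m) (Fin n) ℝ | X.rank ≤ d} (triTraceNorm d) ∧
    (min m n ≤ d → IsQuasiNorm (fun X : Matrix (Fin m) (Fin n) ℝ => triTraceNorm d X)) ∧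
    (∀ X : Matrix (Fin m) (Fin n) ℝ, X.rank ≤ d →
      triTraceNorm d X = schattenNorm (1 / 3) X) := by
  have hS := isQuasiNorm_schattenNorm_third m n
  refine ⟨fun X hX => ?_, ?_, fun hd => ?_, triTraceNorm_eq_schattenNorm_third⟩
  · rw [triTraceNorm_eq_schattenNorm_third X hX]
    exact isLeast_triTraceValues X hX
  · exact hS.isQuasiNormOn_of_eqOn (fun a X hX => (rank_smul_le a X).trans hX)
      triTraceNorm_eq_schattenNorm_third
  · exact hS.isQuasiNormOn_of_eqOn (fun _ _ _ => trivial) fun X _ =>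
      triTraceNorm_eq_schattenNorm_third X ((rank_le_min X).trans hd)
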